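/- Let $R$ be an associative ring with identity, not necessarily commutative; all modules are right $R$-modules. A module is CS if each of its submodules is essential in a direct summand. A module $M$ satisfies $(*)$ if $M=A\oplus B$, where $A$ is either a CS module or a noetherian module, and $B$ is a projective module. A cyclic subfactor of a module $C$ is a cyclic module of the form $X/D$ with submodules $D\subseteq X\subseteq C$. The ring $R$ is a right $WV$-ring if every simple right $R$-module is $R/A$-injective for every right ideal $A$ of $R$ with $R/A\not\cong R$ as right $R$-modules (where $T$ is $N$-injective if every homomorphism from a submodule of $N$ to $T$ extends to $N$). Let $\operatorname{Soc}(C)$ denote the sum of all simple submodules of $C$. **Proposition 9.** Let $C$ be a cyclic right $R$-module such that each cyclic subfactor of $C$ satisfies $(*)$, and let $S=\operatorname{Soc}(C)$. Then $C/S$ has finite uniform dimension, i.e. it has an essential submodule that is the direct sum of $n$ uniform submodules for some integer $n\ge 0$ (a module is uniform if it is nonzero and any two of its nonzero submodules have nonzero intersection). If, furthermore, $R$ is a right $WV$-ring, then $C/S$ is noetherian. -/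

import Mathlib

universe u v

/-- A module is cyclic if it is generated by a single element. -/
def IsCyclicModule (S : Type*) [Ring S] (M : Type*) [AddCommGroup M] [Module S M] : Prop :=
  ∃ x : M, Submodule.span S {x} = ⊤

/-- `N` is an essential submodule of `M`: it meets every nonzero submodule of `M`
nontrivially. -/
def IsEssentialSubmodule {S : Type*} [Ring S] {M : Type*} [AddCommGroup M] [Module S M]
    (N : Submodule S M) : Prop :=
  ∀ K : Submodule S M, N ⊓ K = ⊥ → K = ⊥

/-- A module is uniform if it is nonzero and any two nonzero submodules intersect
nontrivially. -/
def IsUniformModule (S : Type*) [Ring S] (M : Type*) [AddCommGroup M] [Module S M] : Prop :=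
  Nontrivial M ∧ ∀ K L : Submodule S M, K ⊓ L = ⊥ → K = ⊥ ∨ L = ⊥

/-- A module has finite uniform dimension if it has an essential submodule which is a direct
sum of `n` uniform submodules for some `n ≥ 0`. -/
def HasFiniteUniformDimension (S : Type*) [Ring S] (M : Type*) [AddCommGroup M] [Module S M] :
    Prop :=
  ∃ (n : ℕ) (U : Fin n → Submodule S M),
    (∀ i, IsUniformModule S (U i)) ∧ iSupIndep U ∧ IsEssentialSubmodule (⨆ i, U i)

/-- The socle of a module: the sum of its simple submodules. -/
def moduleSocle (S : Type*) [Ring S] (M : Type*) [AddCommGroup M] [Module S M] :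
    Submodule S M :=
  sSup {N : Submodule S M | IsSimpleModule S N}

/-- A module is CS (extending) if every submodule is essential in a direct summand. -/
def IsCSModule (S : Type*) [Ring S] (M : Type*) [AddCommGroup M] [Module S M] : Prop :=
  ∀ N : Submodule S M, ∃ D E : Submodule S M,
    IsCompl D E ∧ N ≤ D ∧ IsEssentialSubmodule (N.submoduleOf D)

/-- The property `(*)`: the module is an internal direct sum `A ⊕ B`, where `A` is CS or
noetherian and `B` is projective. -/
def SatisfiesStar (S : Type*) [Ring S] (M : Type*) [AddCommGroup M] [Module S M] : Prop :=
  ∃ A B : Submodule S M,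
    IsCompl A B ∧ (IsCSModule S A ∨ IsNoetherian S A) ∧ Module.Projective S B

/-- `T` is injective relative to `N` (`N`-injective): every homomorphism from a submodule of `N`
to `T` extends to `N`. -/
def IsRelativelyInjective (S : Type*) [Ring S] (T : Type*) [AddCommGroup T] [Module S T]
    (N : Type*) [AddCommGroup N] [Module S N] : Prop :=
  ∀ (K : Submodule S N) (f : K →ₗ[S] T), ∃ g : N →ₗ[S] T, ∀ x : K, g x = f x

/-- `R` is a right `WV`-ring: every simple right `R`-module is `R / A`-injective for every right
ideal `A` with `R / A` not isomorphic to `R`. Right `R`-modules are modules over `Rᵐᵒᵖ`. Every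
simple right `R`-module is isomorphic to one in the universe of `R`. -/
def IsRightWVRing (R : Type u) [Ring R] : Prop :=
  ∀ A : Submodule Rᵐᵒᵖ R, ¬ Nonempty ((R ⧸ A) ≃ₗ[Rᵐᵒᵖ] R) →
    ∀ (T : Type u) [AddCommGroup T] [Module Rᵐᵒᵖ T],
      IsSimpleModule Rᵐᵒᵖ T → IsRelativelyInjective Rᵐᵒᵖ T (R ⧸ A)

/-! If `E` is essential in `C`, then `C/E` is singular. A singular cyclic module has no nonzero
projective summand, so on cyclic subfactors of `C/E` the property `(*)` reduces to "CS or
noetherian". An Osofsky–Smith argument (`CyclicSubfactorsCSOrNoetherian.finiteGoldie`) then shows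
that `C/E` contains no infinite direct sum of nonzero submodules.

To pass from essential `E` to the socle `S`, choose `K` with `S ⊕ K` essential. An infinite direct
sum inside `K` would contain cyclic pieces `xₙR` with zero socle. Their maximal submodules `Lₙ` are
essential in them, so enlarging `⊕ Lₙ` to an essential submodule gives a quotient of `C` with an
infinite direct sum, which is impossible. Hence `K` has finite Goldie dimension, and so has `C/S`,
an extension of `C/(S ⊕ K)` by `K`.

Over a `WV`-ring the simple modules are injective relative to the singular cyclic module `C/E`, so
maximal submodules separate its submodules. With finite Goldie dimension of all its quotients this
makes `C/E` noetherian (`isNoetherian_of_finiteGoldie_quotient`). Each `L ≤ K` has a finitely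
generated essential submodule `V`, and `L/V` embeds in such a noetherian quotient, so `K` and then
`C/S` are noetherian. -/

/-! ### Essential extensions and independence in modular lattices. -/

section Lattice

/-- `a` is essential in `b`: `a ≤ b` and `a` meets every nonzero element below `b`. -/
def EssentialIn {α : Type*} [Lattice α] [OrderBot α] (a b : α) : Prop :=
  a ≤ b ∧ ∀ c ≤ b, Disjoint a c → c = ⊥

namespace EssentialIn

theorem trans {α : Type*} [Lattice α] [OrderBot α] {a b c : α} (hab : EssentialIn a b)
    (hbc : EssentialIn b c) : EssentialIn a c := by
  refine ⟨hab.1.trans hbc.1, fun d hd h => hbc.2 d hd ?_⟩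
  rw [disjoint_iff]
  exact hab.2 _ inf_le_left (h.mono_right inf_le_right)

theorem disjoint {α : Type*} [Lattice α] [OrderBot α] {a b x : α} (hab : EssentialIn a b)
    (h : Disjoint a x) : Disjoint b x :=
  disjoint_iff.2 (hab.2 _ inf_le_left (h.mono_right inf_le_right))

/-- If `z` misses `p ⊔ f`, the modular law gives `(z ⊔ f) ⊓ (p ⊔ f) = f`. Hence `e ⊓ (z ⊔ f)` misses
`p` and vanishes, which forces `z ≤ f`. -/
theorem sup_right {α : Type*} [Lattice α] [OrderBot α] [IsModularLattice α] {p e f : α}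
    (hp : EssentialIn p e) (h : Disjoint e f) : EssentialIn (p ⊔ f) (e ⊔ f) := by
  refine ⟨sup_le_sup_right hp.1 _, fun z hz hd => ?_⟩
  have h1 : (z ⊔ f) ⊓ (p ⊔ f) = f := by
    rw [sup_comm z f, sup_inf_assoc_of_le _ (le_sup_right : f ≤ p ⊔ f), inf_comm, hd.eq_bot,
      sup_bot_eq]
  have h2 : e ⊓ (z ⊔ f) = ⊥ := by
    refine hp.2 _ inf_le_left ?_
    rw [disjoint_iff_inf_le]
    have : p ⊓ (e ⊓ (z ⊔ f)) ≤ f := h1.le.trans'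
      (le_inf (inf_le_right.trans inf_le_right) (inf_le_left.trans le_sup_left))
    exact (le_inf (inf_le_right.trans inf_le_left) this).trans h.le_bot
  have h3 : z ⊔ f ≤ f := by
    have : z ⊔ f ≤ (f ⊔ e) ⊓ (z ⊔ f) := le_inf (by rw [sup_comm f]; exact sup_le hz le_sup_right)
      le_rfl
    rwa [sup_inf_assoc_of_le _ (le_sup_right : f ≤ z ⊔ f), h2, sup_bot_eq] at this
  have h4 : z ≤ p ⊔ f := (le_sup_left.trans h3).trans le_sup_right
  exact hd.eq_bot_of_ge h4

theorem sup {α : Type*} [Lattice α] [OrderBot α] [IsModularLattice α] {p q e f : α}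
    (hp : EssentialIn p e) (hq : EssentialIn q f) (h : Disjoint e f) :
    EssentialIn (p ⊔ q) (e ⊔ f) := by
  have h1 := hp.sup_right h
  have h2 := hq.sup_right (f := p) (h.symm.mono_right hp.1)
  rw [sup_comm q, sup_comm f] at h2
  exact h2.trans h1

section Families

variable {α : Type*} [CompleteLattice α] [IsModularLattice α] {ι : Type*} {P E : ι → α}

theorem finset_sup (hP : iSupIndep P) (h : ∀ i, EssentialIn (P i) (E i)) (s : Finset ι) :
    s.SupIndep E ∧ EssentialIn (s.sup P) (s.sup E) := by
  classical
  induction s using Finset.induction_on with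
  | empty => exact ⟨Finset.supIndep_empty _, by simp [EssentialIn]⟩
  | insert i s hi ih =>
    have h1 : Disjoint (P i) (s.sup P) :=
      (hP i).mono_right (Finset.sup_le fun j hj =>
        le_iSup₂_of_le j (by rintro rfl; exact hi hj) le_rfl)
    have h2 : Disjoint (E i) (s.sup E) := ((ih.2.disjoint ((h i).disjoint h1).symm)).symm
    refine ⟨ih.1.insert h2, ?_⟩
    rw [Finset.sup_insert, Finset.sup_insert]
    exact (h i).sup ih.2 h2

variable [IsCompactlyGenerated α]

theorem iSupIndep (hP : iSupIndep P) (h : ∀ i, EssentialIn (P i) (E i)) :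
    _root_.iSupIndep E :=
  iSupIndep_iff_supIndep.2 fun s => (finset_sup hP h s).1

theorem iSup (hP : _root_.iSupIndep P) (h : ∀ i, EssentialIn (P i) (E i)) :
    EssentialIn (⨆ i, P i) (⨆ i, E i) := by
  refine ⟨iSup_mono fun i => (h i).1, fun c hc hd => ?_⟩
  have hdir : Directed (· ≤ ·) (fun s : Finset ι => s.sup E) :=
    Monotone.directed_le fun s t hst => Finset.sup_mono hst
  have : Disjoint c (⨆ s : Finset ι, s.sup E) := by
    rw [hdir.disjoint_iSup_right]
    intro s
    rw [disjoint_iff]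
    refine (finset_sup hP h s).2.2 _ inf_le_right ?_
    exact hd.mono (Finset.sup_le fun i _ => le_iSup P i) inf_le_left
  refine this.eq_bot_of_le (hc.trans (iSup_le fun i => ?_))
  exact le_iSup_of_le {i} (by simp)

end Families

end EssentialIn

/-- Any `b` maximal among the elements disjoint from `a` works. Zorn applies because directed
suprema preserve disjointness in a compactly generated lattice. -/
theorem exists_disjoint_essentialIn_sup_top {α : Type*} [CompleteLattice α] [IsModularLattice α]
    [IsCompactlyGenerated α] (a : α) : ∃ b, Disjoint a b ∧ EssentialIn (a ⊔ b) ⊤ := by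
  obtain ⟨b, hb⟩ := zorn_le₀ {b : α | Disjoint a b} fun c hc hch =>
    ⟨sSup c, hch.directedOn.disjoint_sSup_right.2 hc, fun z hz => le_sSup hz⟩
  refine ⟨b, hb.prop, le_top, fun z _ hz => ?_⟩
  have h1 : Disjoint a (b ⊔ z) := hb.prop.disjoint_sup_right_of_disjoint_sup_left hz
  have h2 : z ≤ b := le_sup_right.trans (hb.le_of_ge h1 le_sup_left)
  exact hz.eq_bot_of_ge (h2.trans le_sup_right)

section Sequences

variable {α : Type*} [CompleteLattice α] [IsModularLattice α] [IsCompactlyGenerated α]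

theorem iSupIndep_of_disjoint_range_sup {U : ℕ → α}
    (h : ∀ n, Disjoint (U n) ((Finset.range n).sup U)) : iSupIndep U := by
  have key : ∀ n, (Finset.range n).SupIndep U := by
    intro n
    induction n with
    | zero => exact Finset.supIndep_empty _
    | succ n ih => rw [Finset.range_add_one]; exact ih.insert (h n)
  refine iSupIndep_iff_supIndep.2 fun s => ?_
  obtain ⟨n, hn⟩ := s.exists_nat_subset_range
  exact (key n).subset hn

theorem iSupIndep_of_disjoint_succ {A B : ℕ → α} (hA : ∀ n, A n ≤ B n)
    (hB : ∀ n, B (n + 1) ≤ B n) (h : ∀ n, Disjoint (A n) (B (n + 1))) : iSupIndep A := by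
  have key : ∀ n, Disjoint ((Finset.range n).sup A) (B n) := by
    intro n
    induction n with
    | zero => simp
    | succ n ih =>
      rw [Finset.range_add_one, Finset.sup_insert, sup_comm]
      exact (h n).disjoint_sup_left_of_disjoint_sup_right (ih.mono_right (sup_le (hA n) (hB n)))
  exact iSupIndep_of_disjoint_range_sup fun n => (key n).symm.mono_left (hA n)

end Sequences

end Lattice

/-! ### Finite Goldie dimension. -/

section FiniteGoldie

/-- A module contains no infinite direct sum of nonzero submodules. -/
def FiniteGoldie (R : Type*) [Ring R] (M : Type*) [AddCommGroup M] [Module R M] : Prop :=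
  ∀ U : ℕ → Submodule R M, iSupIndep U → ∃ n, U n = ⊥

variable {R : Type*} [Ring R] {M N P : Type*} [AddCommGroup M] [Module R M] [AddCommGroup N]
  [Module R N] [AddCommGroup P] [Module R P]

theorem FiniteGoldie.of_isNoetherian [IsNoetherian R M] : FiniteGoldie R M := by
  intro U hU
  by_contra! h
  have := WellFoundedGT.finite_of_iSupIndep hU h
  exact not_finite ℕ

theorem map_eq_bot_iff_of_injective {g : M →ₗ[R] N} (hg : Function.Injective g)
    {U : Submodule R M} : U.map g = ⊥ ↔ U = ⊥ := by
  rw [← (Submodule.map_injective_of_injective hg).eq_iff (a := U), Submodule.map_bot]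

theorem iSupIndep_map_of_injective {ι : Type*} {g : M →ₗ[R] N} (hg : Function.Injective g)
    {U : ι → Submodule R M} (hU : iSupIndep U) : iSupIndep fun i => (U i).map g := by
  intro i
  have := Submodule.disjoint_map hg (hU i)
  simpa only [Submodule.map_iSup] using this

theorem iSupIndep_of_map {ι : Type*} {g : M →ₗ[R] N} (hg : Function.Injective g)
    {U : ι → Submodule R M} (hU : iSupIndep fun i => (U i).map g) : iSupIndep U := by
  intro i
  have := hU i
  simp only [← Submodule.map_iSup] at this
  rw [disjoint_iff, ← Submodule.map_inf g hg] at this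
  rw [disjoint_iff]
  exact (map_eq_bot_iff_of_injective hg).1 this

theorem FiniteGoldie.of_injective {g : M →ₗ[R] N} (hg : Function.Injective g)
    (h : FiniteGoldie R N) : FiniteGoldie R M := by
  intro U hU
  obtain ⟨n, hn⟩ := h _ (iSupIndep_map_of_injective hg hU)
  exact ⟨n, (map_eq_bot_iff_of_injective hg).1 hn⟩

/-- An independent sequence of submodules below a `K` of finite Goldie dimension has a zero term. -/
theorem FiniteGoldie.exists_eq_bot_of_le {K : Submodule R M} (h : FiniteGoldie R K)
    {U : ℕ → Submodule R M} (hU : iSupIndep U) (hle : ∀ n, U n ≤ K) : ∃ n, U n = ⊥ := by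
  obtain ⟨n, hn⟩ := h (fun n => (U n).submoduleOf K) <| by
    refine iSupIndep_of_map K.injective_subtype ?_
    refine hU.mono fun n => ?_
    exact Submodule.map_comap_le _ _
  refine ⟨n, ?_⟩
  exact (Submodule.disjoint_iff_comap_eq_bot.2 hn).symm.eq_bot_of_le (hle n)

theorem FiniteGoldie.of_forall_le {K : Submodule R M}
    (h : ∀ U : ℕ → Submodule R M, iSupIndep U → (∀ n, U n ≤ K) → ∃ n, U n = ⊥) :
    FiniteGoldie R K := by
  intro U hU
  obtain ⟨n, hn⟩ := h _ (iSupIndep_map_of_injective K.injective_subtype hU)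
    (fun n => Submodule.map_subtype_le _ _)
  exact ⟨n, (map_eq_bot_iff_of_injective K.injective_subtype).1 hn⟩

/-- Hypothesis `h` is the independence of the images of the `U n` modulo `E`, written without
leaving `M`. -/
theorem not_finiteGoldie_quotient {E : Submodule R M} {U : ℕ → Submodule R M}
    (h : ∀ n, U n ⊓ (E ⊔ ⨆ m ≠ n, U m) ≤ E) (hE : ∀ n, ¬ U n ≤ E) : ¬ FiniteGoldie R (M ⧸ E) := by
  intro hf
  obtain ⟨n, hn⟩ := hf (fun n => (U n).map E.mkQ) <| by
    intro n
    simp only [← Submodule.map_iSup]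
    rw [Submodule.disjoint_def]
    rintro _ ⟨x, hx, rfl⟩ hx'
    rw [← Submodule.mem_comap, Submodule.comap_map_mkQ] at hx'
    exact (Submodule.Quotient.mk_eq_zero _).2 (h n ⟨hx, hx'⟩)
  refine hE n fun x hx => ?_
  have : E.mkQ x ∈ (U n).map E.mkQ := Submodule.mem_map_of_mem hx
  rw [hn, Submodule.mem_bot] at this
  exact (Submodule.Quotient.mk_eq_zero _).1 this

/-- If some tail of an independent sequence misses `ker f`, then `f` embeds that tail in `P`.
Otherwise every tail contains a nonzero kernel element supported on a finite block. Successive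
disjoint blocks give an infinite direct sum in `N`. -/
theorem FiniteGoldie.of_exact {g : N →ₗ[R] M} {f : M →ₗ[R] P} (hg : Function.Injective g)
    (hfg : LinearMap.ker f ≤ LinearMap.range g) (hN : FiniteGoldie R N) (hP : FiniteGoldie R P) :
    FiniteGoldie R M := by
  intro U hU
  by_contra! hne
  by_cases hcase : ∃ n, Disjoint (⨆ i ∈ Set.Ici n, U i) (LinearMap.ker f)
  · obtain ⟨n, hn⟩ := hcase
    obtain ⟨k, hk⟩ := hP (fun k => (U (n + k)).map f) <| by
      intro k
      simp only [← Submodule.map_iSup]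
      rw [Submodule.disjoint_def]
      rintro _ ⟨x, hx, rfl⟩ ⟨y, hy, hxy⟩
      have hle : ∀ j, U (n + j) ≤ ⨆ i ∈ Set.Ici n, U i := fun j =>
        le_iSup₂_of_le (n + j) (Set.mem_Ici.2 (Nat.le_add_right _ _)) le_rfl
      have hx0 : x - y ∈ ⨆ i ∈ Set.Ici n, U i :=
        sub_mem (hle k hx) ((iSup₂_le fun j _ => hle j : (⨆ j ≠ k, U (n + j)) ≤ _) hy)
      have hxy0 : x - y = 0 := Submodule.disjoint_def.1 hn _ hx0 (by simp [hxy])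
      have hind : iSupIndep fun k => U (n + k) := hU.comp (add_right_injective n)
      have : x = 0 := Submodule.disjoint_def.1 (hind k) x hx (by
        rw [sub_eq_zero.1 hxy0]; exact hy)
      simp [this]
    refine hne (n + k) ?_
    rw [← le_bot_iff, Submodule.map_le_iff_le_comap, ← LinearMap.ker] at hk
    exact (hn.mono_left (le_iSup₂_of_le (n + k)
      (Set.mem_Ici.2 (Nat.le_add_right _ _)) le_rfl)).eq_bot_of_le hk
  · have hstep : ∀ n : ℕ, ∃ (m : ℕ) (x : M), x ≠ 0 ∧ f x = 0 ∧ x ∈ ⨆ i ∈ Set.Ico n m, U i := by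
      intro n
      by_contra! h
      refine hcase ⟨n, Submodule.disjoint_def.2 fun x hx hfx => ?_⟩
      by_contra hx0
      rw [iSup_subtype', Submodule.mem_iSup_iff_exists_finset] at hx
      obtain ⟨s, hs⟩ := hx
      obtain ⟨b, hb⟩ := (s.image Subtype.val).exists_nat_subset_range
      refine h b x hx0 hfx ((iSup₂_le fun i hi => ?_ :
        (⨆ i ∈ s, U i) ≤ ⨆ i ∈ Set.Ico n b, U i) hs)
      exact le_iSup₂_of_le i.1
        ⟨i.2, Finset.mem_range.1 (hb (Finset.mem_image_of_mem _ hi))⟩ le_rfl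
    choose m x hx0 hfx hx using hstep
    -- The `k`-th block of indices is `[a k, a (k + 1))`.
    let a : ℕ → ℕ := fun k => Nat.rec 0 (fun _ b => m b) k
    have hm : ∀ n, n < m n := by
      intro n
      by_contra! h
      have := hx n
      rw [Set.Ico_eq_empty (not_lt.2 h)] at this
      simp at this
      exact hx0 n this
    obtain ⟨n, hn⟩ := hN (fun k => Submodule.comap g (R ∙ x (a k))) <| by
      refine iSupIndep_of_map hg ?_
      refine iSupIndep_of_disjoint_succ (B := fun k => ⨆ i ∈ Set.Ici (a k), U i) ?_ ?_ ?_
      · intro k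
        refine (Submodule.map_comap_le _ _).trans ?_
        rw [Submodule.span_singleton_le_iff_mem]
        exact (biSup_mono fun i hi => hi.1 :
          (⨆ i ∈ Set.Ico (a k) (m (a k)), U i) ≤ ⨆ i ∈ Set.Ici (a k), U i) (hx (a k))
      · intro k
        exact biSup_mono fun i hi => (hm (a k)).le.trans hi
      · intro k
        have := hU.disjoint_biSup_biSup (s := Set.Ico (a k) (m (a k))) (t := Set.Ici (a (k + 1)))
          (Set.disjoint_left.2 fun i hi hi' => not_lt.2 hi' hi.2)
        refine this.mono_left ((Submodule.map_comap_le _ _).trans ?_)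
        rw [Submodule.span_singleton_le_iff_mem]
        exact hx (a k)
    obtain ⟨y, hy⟩ := hfg (hfx (a n))
    have : y ∈ Submodule.comap g (R ∙ x (a n)) := by
      rw [Submodule.mem_comap, hy]; exact Submodule.mem_span_singleton_self _
    rw [hn, Submodule.mem_bot] at this
    rw [this, map_zero] at hy
    exact hx0 _ hy.symm

/-- Every module of finite Goldie dimension has an essential submodule which is a finite direct sum
of submodules with a prescribed property, if each nonzero submodule contains a nonzero one. -/
theorem FiniteGoldie.exists_essential (h : FiniteGoldie R M) {p : Submodule R M → Prop}
    (hp : ∀ K : Submodule R M, K ≠ ⊥ → ∃ L ≤ K, L ≠ ⊥ ∧ p L) :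
    ∃ (n : ℕ) (U : ℕ → Submodule R M), (∀ i < n, p (U i)) ∧
      (∀ i < n, Disjoint (U i) ((Finset.range i).sup U)) ∧
      EssentialIn ((Finset.range n).sup U) ⊤ := by
  classical
  by_contra! hcon
  -- Greedy choice of the next summand; `⊥` is only a default for `G` already essential.
  have hstep : ∀ G : Submodule R M, ∃ L : Submodule R M,
      ¬ EssentialIn G ⊤ → (p L ∧ L ≠ ⊥ ∧ Disjoint L G) := by
    intro G
    by_cases hG : EssentialIn G ⊤
    · exact ⟨⊥, fun h => absurd hG h⟩
    · have : ∃ K : Submodule R M, Disjoint G K ∧ K ≠ ⊥ := by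
        by_contra! h'
        exact hG ⟨le_top, fun c _ hc => h' c hc⟩
      obtain ⟨K, hK, hK0⟩ := this
      obtain ⟨L, hL, hL0, hpL⟩ := hp K hK0
      exact ⟨L, fun _ => ⟨hpL, hL0, (hK.mono_right hL).symm⟩⟩
  choose L hL using hstep
  let G : ℕ → Submodule R M := fun k => Nat.rec ⊥ (fun _ b => L b ⊔ b) k
  have hG : ∀ n, (Finset.range n).sup (fun k => L (G k)) = G n := by
    intro n
    induction n with
    | zero => simp [G]
    | succ n ih => rw [Finset.range_add_one, Finset.sup_insert, ih]
  have hG' : ∀ n, ¬ EssentialIn (G n) ⊤ ∧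
      (p (L (G n)) ∧ L (G n) ≠ ⊥ ∧ Disjoint (L (G n)) (G n)) := by
    intro n
    induction n using Nat.strong_induction_on with
    | _ n ih =>
      have : ¬ EssentialIn (G n) ⊤ := by
        rw [← hG n]
        refine hcon n _ (fun i hi => (ih i hi).2.1) (fun i hi => ?_)
        rw [hG i]
        exact (ih i hi).2.2.2
      exact ⟨this, hL _ this⟩
  obtain ⟨n, hn⟩ := h (fun k => L (G k)) (iSupIndep_of_disjoint_range_sup fun n => by
    rw [hG n]; exact (hG' n).2.2.2)
  exact (hG' n).2.2.1 hn

theorem isUniformModule_submodule_iff {U : Submodule R M} : IsUniformModule R U ↔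
    U ≠ ⊥ ∧ ∀ K ≤ U, ∀ L ≤ U, Disjoint K L → K = ⊥ ∨ L = ⊥ := by
  rw [IsUniformModule, Submodule.nontrivial_iff_ne_bot]
  refine and_congr_right fun _ => ⟨fun h K hK L hL hd => ?_, fun h K L hd => ?_⟩
  · refine (h (K.submoduleOf U) (L.submoduleOf U) ?_).imp (fun h => ?_) (fun h => ?_)
    · rw [← le_bot_iff]
      intro x hx
      exact Subtype.ext (Submodule.disjoint_def.1 hd _ hx.1 hx.2)
    · exact (Submodule.disjoint_iff_comap_eq_bot.2 h).symm.eq_bot_of_le hK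
    · exact (Submodule.disjoint_iff_comap_eq_bot.2 h).symm.eq_bot_of_le hL
  · have := h (K.map U.subtype) (Submodule.map_subtype_le _ _) (L.map U.subtype)
      (Submodule.map_subtype_le _ _) (Submodule.disjoint_map U.injective_subtype
        (disjoint_iff.2 hd))
    rwa [map_eq_bot_iff_of_injective U.injective_subtype,
      map_eq_bot_iff_of_injective U.injective_subtype] at this

/-- Without uniform submodules in `K`, every nonzero `B ≤ K` contains some nonzero `A ⊕ B'`.
Iterating on `B'` makes the `A`s an infinite independent sequence. -/
theorem FiniteGoldie.exists_uniform_le (h : FiniteGoldie R M) {K : Submodule R M} (hK : K ≠ ⊥) :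
    ∃ U ≤ K, U ≠ ⊥ ∧ IsUniformModule R U := by
  by_contra! hcon
  have hstep : ∀ B : {B : Submodule R M // B ≤ K ∧ B ≠ ⊥},
      ∃ (A : Submodule R M) (B' : {B : Submodule R M // B ≤ K ∧ B ≠ ⊥}),
        A ≠ ⊥ ∧ A ≤ B ∧ B' ≤ B ∧ Disjoint A B' := by
    rintro ⟨B, hBK, hB⟩
    have := hcon B hBK hB
    rw [isUniformModule_submodule_iff] at this
    push Not at this
    obtain ⟨A, hA, A', hA', hd, h1, h2⟩ := this hB
    exact ⟨A, ⟨A', hA'.trans hBK, h2⟩, h1, hA, hA', hd⟩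
  choose A B' hA0 hA hB' hd using hstep
  let B : ℕ → {B : Submodule R M // B ≤ K ∧ B ≠ ⊥} := fun n =>
    Nat.rec ⟨K, le_rfl, hK⟩ (fun _ b => B' b) n
  obtain ⟨n, hn⟩ := h (fun n => A (B n)) (iSupIndep_of_disjoint_succ (B := fun n => (B n).1)
    (fun n => hA (B n)) (fun n => hB' (B n)) (fun n => hd (B n)))
  exact hA0 _ hn

theorem FiniteGoldie.hasFiniteUniformDimension (h : FiniteGoldie R M) :
    HasFiniteUniformDimension R M := by
  obtain ⟨n, U, h1, h2, h3⟩ := h.exists_essential (p := fun U => IsUniformModule R U)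
    fun K hK => h.exists_uniform_le hK
  refine ⟨n, fun i => U i, fun i => h1 i i.2, ?_, ?_⟩
  · have key : ∀ m ≤ n, (Finset.range m).SupIndep U := by
      intro m hm
      induction m with
      | zero => exact Finset.supIndep_empty _
      | succ m ih => rw [Finset.range_add_one]; exact (ih (by omega)).insert (h2 m (by omega))
    refine iSupIndep_iff_supIndep_univ.2 (Finset.supIndep_map (g := Fin.valEmbedding).1
      ((key n le_rfl).subset fun i => ?_))
    simp +contextual
  · intro K hK
    refine h3.2 K le_top ((disjoint_iff.2 hK).mono_left ?_)
    exact Finset.sup_le fun i hi => le_iSup (fun i : Fin n => U i) ⟨i, Finset.mem_range.1 hi⟩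

end FiniteGoldie

/-! ### Osofsky–Smith: irredundant families of maximal submodules. -/

section OsofskySmith

/-- Every cyclic subfactor of `M` is CS or noetherian. -/
def CyclicSubfactorsCSOrNoetherian (R : Type*) [Ring R] (M : Type v) [AddCommGroup M]
    [Module R M] : Prop :=
  ∀ (Q : Type v) [AddCommGroup Q] [Module R Q], IsCyclicModule R Q →
    (∃ (X : Submodule R M) (f : X →ₗ[R] Q), Function.Surjective f) →
    IsCSModule R Q ∨ IsNoetherian R Q

variable {R : Type*} [Ring R] {M : Type v} [AddCommGroup M] [Module R M]

theorem CyclicSubfactorsCSOrNoetherian.quotient (h : CyclicSubfactorsCSOrNoetherian R M)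
    (E : Submodule R M) : CyclicSubfactorsCSOrNoetherian R (M ⧸ E) := by
  rintro Q _ _ hQ ⟨X, f, hf⟩
  refine h Q hQ ⟨X.comap E.mkQ, f ∘ₗ E.mkQ.submoduleComap X, hf.comp ?_⟩
  rintro ⟨x, hx⟩
  obtain ⟨y, rfl⟩ := E.mkQ_surjective x
  exact ⟨⟨y, hx⟩, rfl⟩

theorem isCyclicModule_span_singleton (x : M) :
    IsCyclicModule R (Submodule.span R {x}) := by
  refine ⟨⟨x, Submodule.mem_span_singleton_self x⟩, ?_⟩
  rw [eq_top_iff]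
  rintro ⟨y, hy⟩ -
  obtain ⟨r, rfl⟩ := Submodule.mem_span_singleton.1 hy
  exact Submodule.mem_span_singleton.2 ⟨r, rfl⟩

theorem IsCyclicModule.of_surjective {N : Type*} [AddCommGroup N] [Module R N]
    (h : IsCyclicModule R M) {f : M →ₗ[R] N} (hf : Function.Surjective f) :
    IsCyclicModule R N := by
  obtain ⟨x, hx⟩ := h
  refine ⟨f x, ?_⟩
  rw [← Set.image_singleton, ← Submodule.map_span, hx, Submodule.map_top,
    LinearMap.range_eq_top.2 hf]

/-- A direct summand of a cyclic module is cyclic. -/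
theorem exists_span_singleton_eq_of_disjoint {D E : Submodule R M} {x : M} (hd : Disjoint D E)
    (hs : D ⊔ E = Submodule.span R {x}) : ∃ d, D = Submodule.span R {d} := by
  have hx : x ∈ D ⊔ E := hs ▸ Submodule.mem_span_singleton_self x
  obtain ⟨d, hdD, e, he, rfl⟩ := Submodule.mem_sup.1 hx
  refine ⟨d, le_antisymm (fun z hz => ?_) ((Submodule.span_singleton_le_iff_mem _ _).2 hdD)⟩
  have hz' : z ∈ Submodule.span R {d + e} := hs ▸ Submodule.mem_sup_left hz
  obtain ⟨r, rfl⟩ := Submodule.mem_span_singleton.1 hz'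
  have h0 : r • e = 0 := by
    refine Submodule.disjoint_def.1 hd _ ?_ (E.smul_mem r he)
    have := D.sub_mem hz (D.smul_mem r hdD)
    rwa [smul_add, add_sub_cancel_left] at this
  rw [smul_add, h0, add_zero]
  exact Submodule.smul_mem _ _ (Submodule.mem_span_singleton_self d)

theorem IsCSModule.exists_closure {X : Type*} [AddCommGroup X] [Module R X] {g : X →ₗ[R] M}
    (h : IsCSModule R X) (hg : Function.Injective g) {N : Submodule R M}
    (hN : N ≤ LinearMap.range g) :
    ∃ D E : Submodule R M, Disjoint D E ∧ D ⊔ E = LinearMap.range g ∧ EssentialIn N D := by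
  obtain ⟨D, E, hDE, hND, hess⟩ := h (N.comap g)
  refine ⟨D.map g, E.map g, Submodule.disjoint_map hg hDE.disjoint, ?_, ?_, fun c hc hd => ?_⟩
  · rw [← Submodule.map_sup, hDE.sup_eq_top, Submodule.map_top]
  · intro x hx
    obtain ⟨y, rfl⟩ := hN hx
    exact ⟨y, hND hx, rfl⟩
  · have h0 := hess ((c.comap g).submoduleOf D) <| by
      rw [← le_bot_iff]
      rintro x ⟨hx1, hx2⟩
      exact Subtype.ext (hg ((Submodule.disjoint_def.1 hd _ hx1 hx2).trans (map_zero g).symm))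
    rw [← le_bot_iff]
    intro x hx
    obtain ⟨y, hy, rfl⟩ := hc hx
    have hmem : (⟨y, hy⟩ : D) ∈ (c.comap g).submoduleOf D := hx
    rw [h0, Submodule.mem_bot] at hmem
    have hy0 : y = 0 := congrArg Subtype.val hmem
    simp [hy0]

theorem IsCSModule.of_linearEquiv {X : Type*} [AddCommGroup X] [Module R X] (h : IsCSModule R X)
    (e : X ≃ₗ[R] M) : IsCSModule R M := by
  intro N
  have htop : LinearMap.range e.toLinearMap = ⊤ := e.range
  obtain ⟨D, E, hd, hs, he⟩ := h.exists_closure (g := e.toLinearMap) e.injective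
    (N := N) (htop ▸ le_top)
  refine ⟨D, E, ⟨hd, codisjoint_iff.2 (hs.trans htop)⟩, he.1, fun K hK => ?_⟩
  refine (map_eq_bot_iff_of_injective D.injective_subtype).1
    (he.2 _ (Submodule.map_subtype_le _ _) (Submodule.disjoint_def.2 ?_))
  rintro _ hx ⟨y, hy, rfl⟩
  have : y ∈ N.submoduleOf D ⊓ K := ⟨hx, hy⟩
  rw [hK, Submodule.mem_bot] at this
  simp [this]

/-- Infinite Goldie dimension rules out the noetherian alternative, so `xR` is CS. The essential
closure of `N` is a summand of `xR`, hence again cyclic. -/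
theorem CyclicSubfactorsCSOrNoetherian.exists_closure (h : CyclicSubfactorsCSOrNoetherian R M)
    {x : M} (hx : ¬ FiniteGoldie R (Submodule.span R {x})) {N : Submodule R M}
    (hN : N ≤ Submodule.span R {x}) :
    ∃ (d : M) (E : Submodule R M), Disjoint (Submodule.span R {d}) E ∧
      Submodule.span R {d} ⊔ E = Submodule.span R {x} ∧ EssentialIn N (Submodule.span R {d}) := by
  have hcs : IsCSModule R (Submodule.span R {x}) :=
    (h _ (isCyclicModule_span_singleton x)
      ⟨_, LinearMap.id, Function.surjective_id⟩).resolve_right fun hn =>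
        hx FiniteGoldie.of_isNoetherian
  obtain ⟨D, E, hd, hs, he⟩ := hcs.exists_closure
    (Submodule.injective_subtype _) (hN.trans (Submodule.range_subtype _).ge)
  rw [Submodule.range_subtype] at hs
  obtain ⟨d, rfl⟩ := exists_span_singleton_eq_of_disjoint hd hs
  exact ⟨d, E, hd, hs, he⟩

theorem not_finiteGoldie_of_le {K : Submodule R M} {U : ℕ → Submodule R M} (hU : iSupIndep U)
    (h0 : ∀ n, U n ≠ ⊥) (hle : ∀ n, U n ≤ K) : ¬ FiniteGoldie R K := fun h =>
  let ⟨n, hn⟩ := h.exists_eq_bot_of_le hU hle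
  h0 n hn

theorem FiniteGoldie.of_isCompl {p q V : Submodule R M} (hpq : IsCompl p q)
    (hq : FiniteGoldie R q) (hV : Disjoint V p) : FiniteGoldie R V := by
  have h1 : FiniteGoldie R (M ⧸ p) :=
    hq.of_injective (g := (p.quotientEquivOfIsCompl q hpq).toLinearMap)
      (p.quotientEquivOfIsCompl q hpq).injective
  refine h1.of_injective (g := p.mkQ ∘ₗ V.subtype) ?_
  rw [← LinearMap.ker_eq_bot, LinearMap.ker_comp, Submodule.ker_mkQ]
  exact Submodule.disjoint_iff_comap_eq_bot.1 hV

/-- Split `B = dR ⊕ E` with `dR` the closure of one term of an infinite direct sum in `B`. Put `C' =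
C ⊕ dR`, `B' = E`, and let `K` be maximal over `C ⊕ E`, so that `K` misses `d`. -/
theorem CyclicSubfactorsCSOrNoetherian.exists_isCoatom_step
    (h : CyclicSubfactorsCSOrNoetherian R M) (hM : IsCyclicModule R M) {C B : Submodule R M}
    (hCB : IsCompl C B) (hB : ¬ FiniteGoldie R B) :
    ∃ C' B' K : Submodule R M, (IsCompl C' B' ∧ ¬ FiniteGoldie R B') ∧ C ≤ C' ∧ B' ≤ B ∧
      IsCoatom K ∧ C ≤ K ∧ B' ≤ K ∧ ¬ C' ⊓ B ≤ K := by
  obtain ⟨x, hx⟩ := hM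
  have hfin : Module.Finite R M := ⟨⟨{x}, by simpa using hx⟩⟩
  obtain ⟨b, rfl⟩ := exists_span_singleton_eq_of_disjoint hCB.disjoint.symm
    (hCB.symm.sup_eq_top.trans hx.symm)
  have : ∃ U : ℕ → Submodule R M, iSupIndep U ∧ (∀ n, U n ≤ Submodule.span R {b}) ∧
      ∀ n, U n ≠ ⊥ := by
    by_contra! h'
    exact hB (FiniteGoldie.of_forall_le h')
  obtain ⟨U, hU, hUb, hU0⟩ := this
  obtain ⟨d, E, hdE, hsup, hess⟩ := h.exists_closure hB (hUb 0)
  have hcomp : IsCompl (C ⊔ Submodule.span R {d}) E :=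
    hdE.isCompl_sup_left_of_isCompl_sup_right (hsup ▸ hCB)
  have hdle : Submodule.span R {d} ≤ Submodule.span R {b} := hsup ▸ le_sup_left
  have hcomp' : IsCompl (Submodule.span R {d}) (C ⊔ E) :=
    (hCB.disjoint.symm.mono_left hdle).isCompl_sup_right_of_isCompl_sup_left
      (sup_comm _ C ▸ hcomp)
  have hd0 : Submodule.span R {d} ≠ ⊥ := fun h' => hU0 0 (le_bot_iff.1 (h' ▸ hess.1))
  have hne : C ⊔ E ≠ ⊤ := fun h' => hd0 (by simpa [h'] using hcomp'.inf_eq_bot)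
  obtain ⟨K, hK, hleK⟩ := (eq_top_or_exists_le_coatom (C ⊔ E)).resolve_left hne
  refine ⟨C ⊔ Submodule.span R {d}, E, K, ⟨hcomp, fun hE => ?_⟩, le_sup_left,
    hsup ▸ le_sup_right, hK, le_sup_left.trans hleK, le_sup_right.trans hleK, fun h' => ?_⟩
  -- The remaining terms `U (n + 1)` miss `C ⊕ dR`, so they embed in `M/(C ⊕ dR) ≅ E`, and `E` stays
  -- infinite dimensional.
  · have hdisj : Disjoint (⨆ n, U (n + 1)) (Submodule.span R {d}) := by
      refine (hess.disjoint ((hU 0).mono_right (iSup_le fun n => ?_))).symm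
      exact le_iSup₂_of_le (n + 1) (Nat.succ_ne_zero n) le_rfl
    have hV : Disjoint (⨆ n, U (n + 1)) (C ⊔ Submodule.span R {d}) := by
      rw [disjoint_iff_inf_le]
      have hle : (⨆ n, U (n + 1)) ⊓ (C ⊔ Submodule.span R {d}) ≤ Submodule.span R {d} := by
        refine (inf_le_inf_right _ (iSup_le fun n => hUb (n + 1))).trans ?_
        rw [inf_comm, sup_comm, sup_inf_assoc_of_le _ hdle, hCB.inf_eq_bot, sup_bot_eq]
      exact (le_inf inf_le_left hle).trans hdisj.le_bot
    exact not_finiteGoldie_of_le (hU.comp (add_left_injective 1)) (fun n => hU0 (n + 1))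
      (fun n => le_iSup (fun n => U (n + 1)) n) (hE.of_isCompl hcomp hV)
  · refine hK.1 (eq_top_iff.2 (hcomp'.sup_eq_top.symm.le.trans (sup_le ?_ hleK)))
    exact (le_inf le_sup_right hdle).trans h'

/-- A cyclic module of infinite Goldie dimension has an infinite irredundant family of maximal
submodules if its cyclic subfactors are CS or noetherian. -/
theorem CyclicSubfactorsCSOrNoetherian.exists_isCoatom
    (h : CyclicSubfactorsCSOrNoetherian R M) (hM : IsCyclicModule R M)
    (hfg : ¬ FiniteGoldie R M) :
    ∃ K : ℕ → Submodule R M, (∀ i, IsCoatom (K i)) ∧ ∀ i, ¬ ⨅ j ≠ i, K j ≤ K i := by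
  have hstep : ∀ p : {p : Submodule R M × Submodule R M // IsCompl p.1 p.2 ∧
      ¬ FiniteGoldie R p.2}, ∃ (p' : {p : Submodule R M × Submodule R M // IsCompl p.1 p.2 ∧
      ¬ FiniteGoldie R p.2}) (K : Submodule R M), p.1.1 ≤ p'.1.1 ∧ p'.1.2 ≤ p.1.2 ∧
      IsCoatom K ∧ p.1.1 ≤ K ∧ p'.1.2 ≤ K ∧ ¬ p'.1.1 ⊓ p.1.2 ≤ K := by
    rintro ⟨⟨C, B⟩, hCB, hB⟩
    obtain ⟨C', B', K, h1, h2⟩ := h.exists_isCoatom_step hM hCB hB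
    exact ⟨⟨(C', B'), h1⟩, K, h2⟩
  choose next K h1 h2 h3 h4 h5 h6 using hstep
  have htop : ¬ FiniteGoldie R (⊤ : Submodule R M) := fun h' =>
    hfg (h'.of_injective (g := Submodule.topEquiv.symm.toLinearMap)
      (LinearEquiv.injective _))
  let p : ℕ → {p : Submodule R M × Submodule R M // IsCompl p.1 p.2 ∧
      ¬ FiniteGoldie R p.2} := fun n => Nat.rec ⟨(⊥, ⊤), isCompl_bot_top, htop⟩
        (fun _ q => next q) n
  have hC : Monotone fun n => (p n).1.1 := monotone_nat_of_le_succ fun n => h1 (p n)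
  have hB : Antitone fun n => (p n).1.2 := antitone_nat_of_succ_le fun n => h2 (p n)
  -- The witness for irredundancy at `i` is `C_{i+1} ⊓ B_i`. It lies below `B_{j+1} ≤ K_j` for `j <
  -- i` and below `C_j ≤ K_j` for `j > i`, but not below `K_i`.
  refine ⟨fun n => K (p n), fun n => h3 _, fun i hi => h6 (p i) (le_trans (le_iInf₂ ?_) hi)⟩
  intro j hj
  rcases lt_or_gt_of_ne hj with hlt | hlt
  · exact inf_le_right.trans ((hB (Nat.succ_le_of_lt hlt)).trans (h5 (p j)))
  · exact inf_le_left.trans ((hC (Nat.succ_le_of_lt hlt)).trans (h4 (p j)))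

section Irredundant

variable {ι : Type*} {K : ι → Submodule R M}

theorem isCompl_finset_sup_inf (hK : ∀ i, IsCoatom (K i)) (hirr : ∀ i, ¬ ⨅ j ≠ i, K j ≤ K i)
    (hbot : ⨅ i, K i = ⊥) (s : Finset ι) :
    IsCompl (s.sup fun i => ⨅ j ≠ i, K j) (s.inf K) := by
  classical
  have hdisj : ∀ i, (⨅ j ≠ i, K j) ⊓ K i = ⊥ := fun i => by
    rw [inf_comm, ← iInf_split_single K i, hbot]
  have hcod : ∀ i, (⨅ j ≠ i, K j) ⊔ K i = ⊤ := fun i => by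
    rw [sup_comm]
    exact (hK i).2 _ (left_lt_sup.2 (hirr i))
  induction s using Finset.induction_on with
  | empty => simpa using isCompl_bot_top
  | insert i s hi ih =>
    have hle : ⨅ j ≠ i, K j ≤ s.inf K := Finset.le_inf fun j hj =>
      iInf₂_le_of_le j (by rintro rfl; exact hi hj) le_rfl
    rw [Finset.sup_insert, Finset.inf_insert]
    constructor
    · rw [disjoint_iff, inf_comm (K i), ← inf_assoc, sup_inf_assoc_of_le _ hle, ih.inf_eq_bot,
        sup_bot_eq, hdisj]
    · have : s.inf K = (⨅ j ≠ i, K j) ⊔ K i ⊓ s.inf K := by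
        rw [← sup_inf_assoc_of_le _ hle, hcod, top_inf_eq]
      rw [codisjoint_iff, sup_comm (⨅ j ≠ i, K j), sup_assoc, ← this, ih.sup_eq_top]

theorem iSupIndep_iInf_ne (hbot : ⨅ i, K i = ⊥) : iSupIndep fun i => ⨅ j ≠ i, K j := by
  intro i
  have : ⨆ j ≠ i, ⨅ k ≠ j, K k ≤ K i :=
    iSup₂_le fun j hj => iInf₂_le_of_le i hj.symm le_rfl
  refine Disjoint.mono_right this ?_
  rw [disjoint_iff, inf_comm, ← iInf_split_single K i, hbot]

/-- Each `⨅ j ≠ i, K j` complements the maximal `K i`, so it is simple. A finitely generated `Z`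
lies in a finite sum of these, which is semisimple, noetherian and a summand of `M`. -/
theorem isNoetherian_and_exists_isCompl_of_le_iSup (hK : ∀ i, IsCoatom (K i))
    (hirr : ∀ i, ¬ ⨅ j ≠ i, K j ≤ K i) (hbot : ⨅ i, K i = ⊥) {Z : Submodule R M} (hZ : Z.FG)
    (hle : Z ≤ ⨆ i, ⨅ j ≠ i, K j) : IsNoetherian R Z ∧ ∃ H, IsCompl Z H := by
  obtain ⟨s, hs⟩ :=
    CompleteLattice.IsCompactElement.exists_finset_of_le_iSup (Submodule _ _)
      ((Submodule.fg_iff_compact Z).1 hZ) _ hle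
  rw [← Finset.sup_eq_iSup] at hs
  have hatom : ∀ i, IsSimpleModule R (⨅ j ≠ i, K j : Submodule R M) := fun i => by
    rw [isSimpleModule_iff_isAtom]
    have := isCompl_finset_sup_inf hK hirr hbot {i}
    rw [Finset.sup_singleton, Finset.inf_singleton] at this
    exact this.isAtom_iff_isCoatom.2 (hK i)
  have hss : IsSemisimpleModule R (s.sup fun i => ⨅ j ≠ i, K j : Submodule R M) := by
    rw [Finset.sup_eq_iSup]
    exact isSemisimpleModule_biSup_of_isSemisimpleModule_submodule
      (s := (s : Set ι)) (p := fun i => ⨅ j ≠ i, K j) fun i _ => inferInstance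
  have hn : IsNoetherian R (s.sup fun i => ⨅ j ≠ i, K j : Submodule R M) := by
    rw [Finset.sup_eq_iSup, iSup_subtype']
    infer_instance
  refine ⟨isNoetherian_of_le hs, ?_⟩
  set G := s.sup fun i => ⨅ j ≠ i, K j
  obtain ⟨W, hW⟩ := exists_isCompl (Z.submoduleOf G)
  have h1 : (Z.submoduleOf G).map G.subtype = Z := by
    rw [Submodule.submoduleOf, Submodule.map_comap_subtype, inf_eq_right.2 hs]
  refine ⟨W.map G.subtype ⊔ s.inf K, ?_⟩
  have hd : Disjoint Z (W.map G.subtype) := by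
    have := Submodule.disjoint_map G.injective_subtype hW.disjoint
    rwa [h1] at this
  refine hd.isCompl_sup_right_of_isCompl_sup_left ?_
  have h2 : Z ⊔ W.map G.subtype = G := by
    rw [← h1, ← Submodule.map_sup, hW.sup_eq_top, Submodule.map_top, Submodule.range_subtype]
  rw [h2]
  exact isCompl_finset_sup_inf hK hirr hbot s

end Irredundant
end OsofskySmith

/-! ### Osofsky–Smith: the contradiction. -/

section OsofskySmithContradiction

variable {R : Type*} [Ring R] {M : Type v} [AddCommGroup M] [Module R M]

/-- If `D / S` is an essential extension of `(F + S) / S`, a submodule of `D` meeting `F` only inside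
`S` lies in `S`. -/
theorem le_of_essentialIn_map_mkQ {S F Z D : Submodule R M} (hSF : S ≤ F)
    (hess : EssentialIn (F.map S.mkQ) (D.map S.mkQ)) (hZ : Z ≤ D) (hZF : Z ⊓ F ≤ S) : Z ≤ S := by
  have h0 := hess.2 (Z.map S.mkQ) (Submodule.map_mono hZ) <| by
    rw [Submodule.disjoint_def]
    rintro _ ⟨x, hx, rfl⟩ ⟨z, hz, hzx⟩
    have hzx' : z - x ∈ S := (Submodule.Quotient.eq S).1 hzx
    have hzF : z ∈ F := by simpa using add_mem (hSF hzx') hx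
    rw [← hzx]
    exact (Submodule.Quotient.mk_eq_zero S).2 (hZF ⟨hz, hzF⟩)
  rw [← le_bot_iff, Submodule.map_le_iff_le_comap] at h0
  intro z hz
  exact (Submodule.Quotient.mk_eq_zero S).1 (h0 hz)

theorem isNoetherian_of_disjoint_of_le_sup {X P Z : Submodule R M} (hd : Disjoint P X)
    (hle : P ≤ X ⊔ Z) [IsNoetherian R Z] : IsNoetherian R P := by
  have h1 : IsNoetherian R (Z.map X.mkQ) :=
    isNoetherian_of_surjective (X.mkQ.submoduleMap Z)
      (LinearMap.range_eq_top.2 (X.mkQ.submoduleMap_surjective Z))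
  have h2 : P.map X.mkQ ≤ Z.map X.mkQ := by
    refine (Submodule.map_mono hle).trans ?_
    rw [Submodule.map_sup, Submodule.mkQ_map_self, bot_sup_eq]
  have h3 : IsNoetherian R (P.map X.mkQ) := isNoetherian_of_le h2
  refine isNoetherian_of_injective (X.mkQ.submoduleMap P) ?_
  rw [← LinearMap.ker_eq_bot, ← le_bot_iff]
  intro x hx
  have : X.mkQ x = 0 := congrArg Subtype.val (LinearMap.mem_ker.1 hx)
  exact Subtype.ext (Submodule.disjoint_def.1 hd _ x.2 ((Submodule.Quotient.mk_eq_zero X).1 this))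

/-- The trace of the closure of an infinite sum `⨆ T` of cyclic pieces on the sum `⨆ E` stays inside
`⨆ T`, because finite subsums of `T` are direct summands. -/
theorem inf_iSup_le_of_essentialIn {E T : ℕ → Submodule R M} {Y : Submodule R M} (hE : iSupIndep E)
    (hTE : ∀ k, T k ≤ E k) (hess : EssentialIn (⨆ k, T k) Y)
    (hcompl : ∀ s : Finset ℕ, ∃ H, IsCompl (s.sup T) H) : Y ⊓ ⨆ k, E k ≤ ⨆ k, T k := by
  rintro z ⟨hzY, hzE⟩
  obtain ⟨s, hs⟩ := (Submodule.mem_iSup_iff_exists_finset).1 hzE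
  rw [← Finset.sup_eq_iSup] at hs
  obtain ⟨H, hH⟩ := hcompl s
  have hGT : s.sup T ≤ ⨆ k, T k := Finset.sup_le fun k _ => le_iSup T k
  have hGE : s.sup T ≤ s.sup E := Finset.sup_mono_fun fun k _ => hTE k
  have hGY : s.sup T ≤ Y ⊓ s.sup E := le_inf (hGT.trans hess.1) hGE
  have hT : ⨆ k, T k ≤ s.sup T ⊔ ⨆ k ∈ (s : Set ℕ)ᶜ, E k := by
    refine iSup_le fun k => ?_
    by_cases hk : k ∈ s
    · exact (Finset.le_sup hk).trans le_sup_left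
    · exact (hTE k).trans (le_sup_of_le_right (le_iSup₂_of_le k (by simpa using hk) le_rfl))
  have hdis : s.sup E ⊓ ⨆ k ∈ (s : Set ℕ)ᶜ, E k = ⊥ := by
    have := hE.disjoint_biSup_biSup (s := (s : Set ℕ)) (t := (s : Set ℕ)ᶜ) disjoint_compl_right
    rw [Finset.sup_eq_iSup]
    exact this.eq_bot
  have hET : s.sup E ⊓ ⨆ k, T k ≤ s.sup T := by
    refine (inf_le_inf_left _ hT).trans ?_
    rw [inf_comm, sup_inf_assoc_of_le _ hGE, inf_comm, hdis, sup_bot_eq]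
  -- By independence of `E`, `⨆ T` meets `s.sup E` only in `s.sup T`, which `H` misses; essentiality
  -- in `Y` concludes.
  have h0 : H ⊓ (Y ⊓ s.sup E) = ⊥ := by
    refine hess.2 _ (inf_le_right.trans inf_le_left) ?_
    rw [disjoint_iff_inf_le]
    have h1 : (⨆ k, T k) ⊓ (H ⊓ (Y ⊓ s.sup E)) ≤ s.sup T :=
      (le_inf (inf_le_right.trans (inf_le_right.trans inf_le_right)) inf_le_left).trans hET
    exact (le_inf h1 (inf_le_right.trans inf_le_left)).trans hH.inf_eq_bot.le
  have h2 : Y ⊓ s.sup E ≤ s.sup T := by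
    have : (s.sup T ⊔ H) ⊓ (Y ⊓ s.sup E) = s.sup T := by
      rw [sup_inf_assoc_of_le _ hGY, h0, sup_bot_eq]
    rw [hH.sup_eq_top, top_inf_eq] at this
    exact this.le
  exact hGT (h2 ⟨hzY, hs⟩)

/-- Close each row of `S` to a cyclic `e_k R`, then close `⊕ e_k R` modulo `S₀ = ⨆ S` to the image
of `dR`. Choose nonzero `t_k` in `dR` and row `k`, and close `⊕ t_k R` inside `dR` to `yR`. Then
`yR` meets `⊕ e_k R` only inside `S₀`, so `yR ≤ S₀` and `yR` is noetherian, yet it contains `⊕ t_k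
R`. -/
theorem CyclicSubfactorsCSOrNoetherian.false_of_iSupIndep
    (h : CyclicSubfactorsCSOrNoetherian R M) {x : M} (hx : Submodule.span R {x} = ⊤)
    {S : ℕ × ℕ → Submodule R M} (hS : iSupIndep S) (hS0 : ∀ i, S i ≠ ⊥)
    (hfg : ∀ Z : Submodule R M, Z.FG → Z ≤ ⨆ i, S i → IsNoetherian R Z ∧ ∃ H, IsCompl Z H) :
    False := by
  have hfin : Module.Finite R M := ⟨⟨{x}, by simpa using hx⟩⟩
  have hSk : ∀ k, iSupIndep fun j => S (k, j) := fun k => hS.comp (Prod.mk_right_injective k)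
  have hP : iSupIndep fun k => ⨆ j, S (k, j) := by
    intro k
    have := hS.disjoint_biSup_biSup (s := {i | i.1 = k}) (t := {i | i.1 = k}ᶜ)
      disjoint_compl_right
    refine this.mono (iSup_le fun j => le_iSup₂_of_le (k, j) rfl le_rfl) ?_
    exact iSup₂_le fun m hm => iSup_le fun j => le_iSup₂_of_le (m, j) hm le_rfl
  have hSP : ⨆ i, S i = ⨆ k, ⨆ j, S (k, j) := iSup_prod
  have hM : ¬ FiniteGoldie R (Submodule.span R {x}) :=
    not_finiteGoldie_of_le (hSk 0) (fun n => hS0 _) fun n => hx ▸ le_top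
  have hnoeth : ∀ y : M, Submodule.span R {y} ≤ ⨆ i, S i → IsNoetherian R (Submodule.span R {y}) :=
    fun y hy => (hfg _ (Submodule.fg_span_singleton y) hy).1
  have hcl : ∀ k, ∃ e : M, EssentialIn (⨆ j, S (k, j)) (Submodule.span R {e}) := fun k =>
    let ⟨d, _, _, _, hd⟩ := h.exists_closure hM (N := ⨆ j, S (k, j)) (hx ▸ le_top)
    ⟨d, hd⟩
  choose e he using hcl
  have hE : iSupIndep fun k => Submodule.span R {e k} := EssentialIn.iSupIndep hP he
  have hEk : ∀ k, ¬ Submodule.span R {e k} ≤ ⨆ i, S i := fun k hk => by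
    have := hnoeth _ hk
    exact not_finiteGoldie_of_le (hSk k) (fun n => hS0 _)
      (fun n => (le_iSup (fun j => S (k, j)) n).trans (he k).1) FiniteGoldie.of_isNoetherian
  have hSF : ⨆ i, S i ≤ ⨆ k, Submodule.span R {e k} := hSP ▸ iSup_mono fun k => (he k).1
  have hquot : ¬ FiniteGoldie R (M ⧸ ⨆ i, S i) := by
    refine not_finiteGoldie_quotient (U := fun k => Submodule.span R {e k}) (fun k => ?_) hEk
    have h1 : (⨆ i, S i) ⊔ ⨆ m ≠ k, Submodule.span R {e m} ≤
        (⨆ j, S (k, j)) ⊔ ⨆ m ≠ k, Submodule.span R {e m} := by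
      refine sup_le ?_ le_sup_right
      rw [hSP, iSup_split_single _ k]
      exact sup_le_sup_left (iSup₂_mono fun m _ => (he m).1) _
    refine (inf_le_inf_left _ h1).trans ?_
    rw [inf_comm, sup_inf_assoc_of_le _ (he k).1, inf_comm, (hE k).eq_bot, sup_bot_eq, hSP]
    exact le_iSup (fun k => ⨆ j, S (k, j)) k
  set S₀ := ⨆ i, S i
  have hxq : Submodule.span R {S₀.mkQ x} = ⊤ := by
    rw [← Set.image_singleton, ← Submodule.map_span, hx, Submodule.map_top, Submodule.range_mkQ]
  have hquot' : ¬ FiniteGoldie R (Submodule.span R {S₀.mkQ x}) := fun h' => hquot <| by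
    rw [hxq] at h'
    exact h'.of_injective (g := Submodule.topEquiv.symm.toLinearMap) (LinearEquiv.injective _)
  obtain ⟨d', -, -, -, hd'⟩ := (h.quotient S₀).exists_closure hquot'
    (N := (⨆ k, Submodule.span R {e k}).map S₀.mkQ) (hxq ▸ le_top)
  obtain ⟨d, rfl⟩ := S₀.mkQ_surjective d'
  have hd : EssentialIn ((⨆ k, Submodule.span R {e k}).map S₀.mkQ)
      ((Submodule.span R {d}).map S₀.mkQ) := by
    rwa [Submodule.map_span, Set.image_singleton]
  have hed : ∀ k, e k ∈ Submodule.span R {d} ⊔ S₀ := fun k => by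
    rw [sup_comm, ← Submodule.comap_map_mkQ]
    exact hd.1 (Submodule.mem_map_of_mem
      (Submodule.mem_iSup_of_mem k (Submodule.mem_span_singleton_self _)))
  -- If `dR` missed row `k`, that row would embed in `(dR + sR)/dR` with `s ∈ S₀`, a noetherian
  -- module.
  have hmeet : ∀ k, ∃ t, t ∈ Submodule.span R {d} ∧ t ∈ ⨆ j, S (k, j) ∧ t ≠ 0 := by
    intro k
    by_contra! hcon
    obtain ⟨y, hy, s, hs, hys⟩ := Submodule.mem_sup.1 (hed k)
    have hs' : Submodule.span R {s} ≤ S₀ := (Submodule.span_singleton_le_iff_mem _ _).2 hs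
    have := hnoeth s hs'
    have hle : ⨆ j, S (k, j) ≤ Submodule.span R {d} ⊔ Submodule.span R {s} := by
      refine (he k).1.trans ((Submodule.span_singleton_le_iff_mem _ _).2 ?_)
      rw [← hys]
      exact Submodule.add_mem_sup hy (Submodule.mem_span_singleton_self s)
    have hdisj : Disjoint (⨆ j, S (k, j)) (Submodule.span R {d}) :=
      Submodule.disjoint_def.2 fun t ht htd => hcon t htd ht
    have := isNoetherian_of_disjoint_of_le_sup hdisj hle
    exact not_finiteGoldie_of_le (hSk k) (fun n => hS0 _)
      (fun n => le_iSup (fun j => S (k, j)) n) FiniteGoldie.of_isNoetherian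
  choose t htd htP ht0 using hmeet
  have htP' : ∀ k, Submodule.span R {t k} ≤ ⨆ j, S (k, j) := fun k =>
    (Submodule.span_singleton_le_iff_mem _ _).2 (htP k)
  have htd' : ∀ k, Submodule.span R {t k} ≤ Submodule.span R {d} := fun k =>
    (Submodule.span_singleton_le_iff_mem _ _).2 (htd k)
  have hT : iSupIndep fun k => Submodule.span R {t k} := hP.mono htP'
  have hT0 : ∀ k, Submodule.span R {t k} ≠ ⊥ := fun k =>
    (Submodule.span_singleton_eq_bot).not.2 (ht0 k)
  have hTS : ∀ k, Submodule.span R {t k} ≤ S₀ := fun k =>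
    (htP' k).trans (hSP ▸ le_iSup (fun k => ⨆ j, S (k, j)) k)
  obtain ⟨y, E', -, hsup, hy⟩ := h.exists_closure (not_finiteGoldie_of_le hT hT0 htd')
    (iSup_le htd')
  have hyS : ¬ Submodule.span R {y} ≤ S₀ := fun hy' => by
    have := hnoeth _ hy'
    exact not_finiteGoldie_of_le hT hT0
      (fun n => (le_iSup (fun k => Submodule.span R {t k}) n).trans hy.1)
      FiniteGoldie.of_isNoetherian
  refine hyS (le_of_essentialIn_map_mkQ hSF hd (hsup ▸ le_sup_left) ?_)
  refine (inf_iSup_le_of_essentialIn hE (fun k => (htP' k).trans (he k).1) hy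
    fun s => ?_).trans (iSup_le hTS)
  refine (hfg _ ?_ (Finset.sup_le fun k _ => hTS k)).2
  exact Submodule.fg_finset_sup _ _ fun k _ => Submodule.fg_span_singleton _

/-- Osofsky-Smith: a cyclic module whose cyclic subfactors are CS or noetherian has finite Goldie
dimension. -/
theorem CyclicSubfactorsCSOrNoetherian.finiteGoldie (h : CyclicSubfactorsCSOrNoetherian R M)
    (hM : IsCyclicModule R M) : FiniteGoldie R M := by
  by_contra hfg
  obtain ⟨K, hK, hirr⟩ := h.exists_isCoatom hM hfg
  set J := ⨅ i, K i
  have hJ : ∀ i, ((K i).map J.mkQ).comap J.mkQ = K i := fun i => by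
    rw [Submodule.comap_map_mkQ, sup_eq_right]
    exact iInf_le K i
  have hcomap := Submodule.comap_injective_of_surjective J.mkQ_surjective
  -- Re-indexing by pairs provides infinitely many infinite rows.
  let e : ℕ × ℕ ≃ ℕ := Nat.pairEquiv
  let K' : ℕ × ℕ → Submodule R (M ⧸ J) := fun i => (K (e i)).map J.mkQ
  have hK' : ∀ i, IsCoatom (K' i) := by
    intro i
    refine ⟨fun htop => (hK (e i)).1 ?_, fun L hL => ?_⟩
    · rw [← hJ, show (K (e i)).map J.mkQ = ⊤ from htop, Submodule.comap_top]
    · refine hcomap (((hK (e i)).2 (L.comap J.mkQ) ?_).trans (Submodule.comap_top _).symm)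
      rw [← hJ (e i)]
      exact lt_of_le_of_ne (Submodule.comap_mono hL.le) fun h' => hL.ne (hcomap h')
  have hirr' : ∀ i, ¬ ⨅ j ≠ i, K' j ≤ K' i := by
    intro i hi
    refine hirr (e i) ?_
    have := Submodule.comap_mono (f := J.mkQ) hi
    simp only [Submodule.comap_iInf, K', hJ] at this
    refine le_trans (le_iInf₂ fun j hj => ?_) this
    exact iInf₂_le_of_le (e j) (e.injective.ne hj) le_rfl
  have hbot : ⨅ i, K' i = ⊥ := by
    refine hcomap ?_
    simp only [Submodule.comap_iInf, K', hJ]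
    rw [e.iInf_comp (g := K), Submodule.comap_bot, Submodule.ker_mkQ]
  obtain ⟨x, hx⟩ := hM.of_surjective J.mkQ_surjective
  refine (h.quotient J).false_of_iSupIndep hx (iSupIndep_iInf_ne hbot) (fun i hi => hirr' i ?_)
    fun Z hZ hle => isNoetherian_and_exists_isCompl_of_le_iSup hK' hirr' hbot hZ hle
  rw [hi]
  exact bot_le

end OsofskySmithContradiction

/-! ### Singular modules and the property `(*)`. -/

section Singular

variable {R : Type*} [Ring R] {M : Type v} [AddCommGroup M] [Module R M]

theorem EssentialIn.mono_left {α : Type*} [Lattice α] [OrderBot α] {a b c : α}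
    (h : EssentialIn a c) (hab : a ≤ b) (hbc : b ≤ c) : EssentialIn b c :=
  ⟨hbc, fun d hd hbd => h.2 d hd (hbd.mono_left hab)⟩

theorem EssentialIn.comap {N : Type*} [AddCommGroup N] [Module R N] {L : Submodule R N}
    (h : EssentialIn L ⊤) (f : M →ₗ[R] N) : EssentialIn (L.comap f) ⊤ := by
  refine ⟨le_top, fun Z _ hd => ?_⟩
  have h0 := h.2 (Z.map f) le_top <| by
    rw [Submodule.disjoint_def]
    rintro _ hx ⟨z, hz, rfl⟩
    rw [Submodule.disjoint_def.1 hd z hx hz, map_zero]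
  rw [← le_bot_iff, Submodule.map_le_iff_le_comap] at h0
  exact hd.eq_bot_of_ge (h0.trans (Submodule.comap_mono bot_le))

/-- A module is singular if every element is annihilated by an essential left ideal. -/
def IsSingularModule (R : Type*) [Ring R] (M : Type*) [AddCommGroup M] [Module R M] : Prop :=
  ∀ x : M, EssentialIn (LinearMap.ker (LinearMap.toSpanSingleton R M x)) ⊤

theorem isSingularModule_quotient {E : Submodule R M} (hE : EssentialIn E ⊤) :
    IsSingularModule R (M ⧸ E) := by
  intro x
  obtain ⟨y, rfl⟩ := E.mkQ_surjective x
  refine (hE.comap (LinearMap.toSpanSingleton R M y)).mono_left (fun r hr => ?_) le_top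
  rw [LinearMap.mem_ker, LinearMap.toSpanSingleton_apply, ← map_smul]
  exact (Submodule.Quotient.mk_eq_zero E).2 hr

theorem IsSingularModule.of_surjective {Q : Type*} [AddCommGroup Q] [Module R Q]
    (h : IsSingularModule R M) {X : Submodule R M} {f : X →ₗ[R] Q} (hf : Function.Surjective f) :
    IsSingularModule R Q := by
  intro q
  obtain ⟨x, rfl⟩ := hf q
  refine (h x).mono_left (fun r hr => ?_) le_top
  have h0 : r • x = 0 := Subtype.ext hr
  rw [LinearMap.mem_ker, LinearMap.toSpanSingleton_apply, ← map_smul, h0, map_zero]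

/-- The projective summand is cyclic, `bR`, so `R → bR` splits. The splitting's image misses the
kernel, which is essential by singularity, hence `b = 0`. -/
theorem IsSingularModule.csOrNoetherian_of_star (h : IsSingularModule R M)
    (hM : IsCyclicModule R M) (hstar : SatisfiesStar R M) : IsCSModule R M ∨ IsNoetherian R M := by
  obtain ⟨A, B, hAB, hA, hB⟩ := hstar
  obtain ⟨x, hx⟩ := hM
  obtain ⟨b, rfl⟩ := exists_span_singleton_eq_of_disjoint hAB.disjoint.symm
    (hAB.symm.sup_eq_top.trans hx.symm)
  let b' : Submodule.span R {b} := ⟨b, Submodule.mem_span_singleton_self b⟩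
  let f : R →ₗ[R] Submodule.span R {b} := LinearMap.toSpanSingleton R _ b'
  have hf : Function.Surjective f := by
    rintro ⟨y, hy⟩
    obtain ⟨r, rfl⟩ := Submodule.mem_span_singleton.1 hy
    exact ⟨r, rfl⟩
  obtain ⟨g, hg⟩ := Module.projective_lifting_property f LinearMap.id hf
  have hfg : ∀ y, f (g y) = y := fun y => LinearMap.congr_fun hg y
  have hb0 : b' = 0 := by
    have hess : EssentialIn (LinearMap.ker f) ⊤ :=
      (h b).mono_left (fun r hr => Subtype.ext hr) le_top
    have h0 := hess.2 (LinearMap.range g) le_top <| by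
      rw [Submodule.disjoint_def]
      rintro _ hy ⟨y, rfl⟩
      rw [LinearMap.mem_ker, hfg] at hy
      rw [hy, map_zero]
    have : g b' = 0 := by
      rw [← Submodule.mem_bot R, ← h0]
      exact LinearMap.mem_range_self g b'
    rw [← hfg b', this, map_zero]
  have hb : b = 0 := congrArg Subtype.val hb0
  have hA' : A = ⊤ := by simpa [hb] using hAB.sup_eq_top
  subst hA'
  refine hA.imp (fun h' => h'.of_linearEquiv Submodule.topEquiv) (fun h' => ?_)
  have : IsNoetherian R (⊤ : Submodule R M) := h'
  exact isNoetherian_of_linearEquiv Submodule.topEquiv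

theorem cyclicSubfactors_quotient_of_star {E : Submodule R M} (hE : EssentialIn E ⊤)
    (hstar : ∀ (X : Submodule R M) (D : Submodule R X),
      IsCyclicModule R (X ⧸ D) → SatisfiesStar R (X ⧸ D)) :
    CyclicSubfactorsCSOrNoetherian R (M ⧸ E) := by
  rintro Q _ _ hQ ⟨X, f, hf⟩
  let f' : X.comap E.mkQ →ₗ[R] Q := f ∘ₗ E.mkQ.submoduleComap X
  have hf' : Function.Surjective f' := by
    refine hf.comp ?_
    rintro ⟨x, hx⟩
    obtain ⟨y, rfl⟩ := E.mkQ_surjective x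
    exact ⟨⟨y, hx⟩, rfl⟩
  let e := f'.quotKerEquivOfSurjective hf'
  have hcyc : IsCyclicModule R (X.comap E.mkQ ⧸ LinearMap.ker f') :=
    hQ.of_surjective (f := e.symm.toLinearMap) e.symm.surjective
  have hsing : IsSingularModule R (X.comap E.mkQ ⧸ LinearMap.ker f') :=
    (isSingularModule_quotient hE).of_surjective (f := e.symm.toLinearMap ∘ₗ f)
      (e.symm.surjective.comp hf)
  refine (hsing.csOrNoetherian_of_star hcyc (hstar _ _ hcyc)).imp (fun h => h.of_linearEquiv e)
    (fun h => ?_)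
  have : IsNoetherian R (X.comap E.mkQ ⧸ LinearMap.ker f') := h
  exact isNoetherian_of_linearEquiv e

end Singular

/-! ### From quotients by essential submodules to the quotient by the socle. -/

section Socle

variable {R : Type*} [Ring R] {M : Type v} [AddCommGroup M] [Module R M]

/-- Take `L` maximal in `xR`. A nonzero `c ≤ xR` missing `L` would complement it, hence be simple
and lie in the socle. -/
theorem exists_essentialIn_span_of_disjoint_socle {N : Submodule R M} (hN : N ≠ ⊥)
    (hd : Disjoint (moduleSocle R M) N) :
    ∃ x ∈ N, ∃ L : Submodule R M, EssentialIn L (Submodule.span R {x}) ∧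
      ¬ Submodule.span R {x} ≤ L := by
  obtain ⟨x, hxN, hx0⟩ := N.exists_mem_ne_zero_of_ne_bot hN
  have := CompleteLattice.Iic_coatomic_of_compact_element
    (Submodule.singleton_span_isCompactElement (R := R) x)
  have hne : (⊥ : Set.Iic (Submodule.span R {x})) ≠ ⊤ := fun h =>
    hx0 (Submodule.span_singleton_eq_bot.1 (congrArg Subtype.val h).symm)
  obtain ⟨⟨L, hL⟩, hcoatom, -⟩ :=
    (eq_top_or_exists_le_coatom (⊥ : Set.Iic (Submodule.span R {x}))).resolve_left hne
  have hcov : L ⋖ Submodule.span R {x} := Set.Iic.isCoatom_iff.1 hcoatom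
  refine ⟨x, hxN, L, ⟨hL, fun c hc hLc => ?_⟩, hcov.lt.not_ge⟩
  by_contra hc0
  have hsup : L ⊔ c = Submodule.span R {x} :=
    (hcov.eq_or_eq le_sup_left (sup_le hL hc)).resolve_left fun h =>
      hc0 (hLc.eq_bot_of_ge (h ▸ le_sup_right))
  have hatom : IsAtom c := by
    rw [← bot_covBy_iff, ← hLc.eq_bot]
    exact inf_covBy_of_covBy_sup_left (hsup.symm ▸ hcov)
  have hcS : c ≤ moduleSocle R M := le_sSup (isSimpleModule_iff_isAtom.2 hatom)
  have hcN : c ≤ N := hc.trans ((Submodule.span_singleton_le_iff_mem _ _).2 hxN)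
  exact hc0 (le_bot_iff.1 (hd hcS hcN))

/-- If the quotients by essential submodules have finite Goldie dimension, so has a complement of
the socle. -/
theorem finiteGoldie_of_disjoint_socle
    (h : ∀ E : Submodule R M, EssentialIn E ⊤ → FiniteGoldie R (M ⧸ E)) {K : Submodule R M}
    (hd : Disjoint (moduleSocle R M) K) : FiniteGoldie R K := by
  refine FiniteGoldie.of_forall_le fun U hU hUK => ?_
  by_contra! hU0
  choose x hx L hL hLx using fun n =>
    exists_essentialIn_span_of_disjoint_socle (hU0 n) (hd.mono_right (hUK n))
  have hind : iSupIndep fun n => Submodule.span R {x n} :=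
    hU.mono fun n => (Submodule.span_singleton_le_iff_mem _ _).2 (hx n)
  obtain ⟨W, hW, hess⟩ := exists_disjoint_essentialIn_sup_top (⨆ n, Submodule.span R {x n})
  have hE : EssentialIn ((⨆ n, L n) ⊔ W) ⊤ :=
    ((EssentialIn.iSup (hind.mono fun n => (hL n).1) hL).sup_right hW).trans hess
  have hLE : ∀ n, L n ≤ (⨆ n, L n) ⊔ W := fun n => (le_iSup L n).trans le_sup_left
  -- Modulo `⊕ Lₙ ⊕ W` the `xₙR` stay independent, each with nonzero image `xₙR/Lₙ`.
  have key : ∀ n, Submodule.span R {x n} ⊓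
      ((⨆ n, L n) ⊔ W ⊔ ⨆ m ≠ n, Submodule.span R {x m}) ≤ L n := by
    intro n
    have hle : (⨆ n, L n) ⊔ W ⊔ ⨆ m ≠ n, Submodule.span R {x m} ≤
        L n ⊔ ((⨆ m ≠ n, Submodule.span R {x m}) ⊔ W) := by
      refine sup_le (sup_le ?_ (le_sup_right.trans le_sup_right)) (le_sup_left.trans le_sup_right)
      rw [iSup_split_single L n]
      exact sup_le_sup_left ((iSup₂_mono fun m _ => (hL m).1).trans le_sup_left) _
    have hdis : Disjoint (Submodule.span R {x n})
        ((⨆ m ≠ n, Submodule.span R {x m}) ⊔ W) := by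
      refine (hind n).disjoint_sup_right_of_disjoint_sup_left ?_
      rwa [← iSup_split_single (fun n => Submodule.span R {x n}) n]
    refine (inf_le_inf_left _ hle).trans ?_
    rw [inf_comm, sup_inf_assoc_of_le _ (hL n).1, inf_comm, hdis.eq_bot, sup_bot_eq]
  refine not_finiteGoldie_quotient (fun n => (key n).trans (hLE n)) (fun n hn => ?_) (h _ hE)
  exact hLx n ((le_inf le_rfl (hn.trans le_sup_left)).trans (key n))

theorem ker_factor_sup_eq_range (S K : Submodule R M) :
    LinearMap.range (S.mkQ ∘ₗ K.subtype) =
      LinearMap.ker (Submodule.factor (le_sup_left : S ≤ S ⊔ K)) := by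
  ext x
  obtain ⟨y, rfl⟩ := S.mkQ_surjective x
  constructor
  · rintro ⟨k, hk⟩
    rw [← hk]
    exact (Submodule.Quotient.mk_eq_zero _).2 (Submodule.mem_sup_right k.2)
  · intro hy
    have hy' : y ∈ S ⊔ K := (Submodule.Quotient.mk_eq_zero _).1 hy
    obtain ⟨s, hs, k, hk, rfl⟩ := Submodule.mem_sup.1 hy'
    refine ⟨⟨k, hk⟩, ?_⟩
    rw [map_add, show S.mkQ s = 0 from (Submodule.Quotient.mk_eq_zero _).2 hs, zero_add]
    rfl

theorem finiteGoldie_quotient_socle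
    (h : ∀ E : Submodule R M, EssentialIn E ⊤ → FiniteGoldie R (M ⧸ E)) :
    FiniteGoldie R (M ⧸ moduleSocle R M) := by
  obtain ⟨K, hd, hess⟩ := exists_disjoint_essentialIn_sup_top (moduleSocle R M)
  refine FiniteGoldie.of_exact (g := (moduleSocle R M).mkQ ∘ₗ K.subtype) ?_
    (ker_factor_sup_eq_range _ K).ge (finiteGoldie_of_disjoint_socle h hd) (h _ hess)
  rw [← LinearMap.ker_eq_bot, LinearMap.ker_comp, Submodule.ker_mkQ]
  exact Submodule.disjoint_iff_comap_eq_bot.1 hd.symm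

/-- A module of finite Goldie dimension has a finitely generated essential submodule. -/
theorem FiniteGoldie.exists_fg_essentialIn {L : Submodule R M} (h : FiniteGoldie R L) :
    ∃ V : Submodule R M, V.FG ∧ EssentialIn V L := by
  obtain ⟨n, U, hU, -, hess⟩ := h.exists_essential (p := fun U => U.FG) fun K hK => by
    obtain ⟨x, hxK, hx0⟩ := K.exists_mem_ne_zero_of_ne_bot hK
    exact ⟨Submodule.span R {x}, (Submodule.span_singleton_le_iff_mem _ _).2 hxK,
      Submodule.span_singleton_eq_bot.not.2 hx0, Submodule.fg_span_singleton x⟩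
  refine ⟨((Finset.range n).sup U).map L.subtype, (Submodule.fg_finset_sup _ _ fun i hi =>
    hU i (Finset.mem_range.1 hi)).map _, Submodule.map_subtype_le _ _, fun c hc hd => ?_⟩
  have := hess.2 (c.submoduleOf L) le_top <| Submodule.disjoint_def.2 fun x hx hxc =>
    Subtype.ext (Submodule.disjoint_def.1 hd _ (Submodule.mem_map_of_mem hx) hxc)
  exact (Submodule.disjoint_iff_comap_eq_bot.2 this).symm.eq_bot_of_le hc

theorem isNoetherian_quotient_socle
    (h : ∀ E : Submodule R M, EssentialIn E ⊤ → IsNoetherian R (M ⧸ E)) :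
    IsNoetherian R (M ⧸ moduleSocle R M) := by
  obtain ⟨K, hd, hess⟩ := exists_disjoint_essentialIn_sup_top (moduleSocle R M)
  have hfin : ∀ L ≤ K, FiniteGoldie R L := fun L hL =>
    finiteGoldie_of_disjoint_socle (fun E hE => have := h E hE; FiniteGoldie.of_isNoetherian)
      (hd.mono_right hL)
  have hK : IsNoetherian R K := by
    rw [isNoetherian_submodule]
    intro L hL
    obtain ⟨V, hV, hVL⟩ := (hfin L hL).exists_fg_essentialIn
    obtain ⟨W, hW, hLW⟩ := exists_disjoint_essentialIn_sup_top L
    have := h _ ((hVL.sup_right hW).trans hLW)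
    -- `L ⊓ (V ⊔ W) = V` is finitely generated, and the image of `L` lies in a noetherian quotient.
    refine Submodule.fg_of_fg_map_of_fg_inf_ker (V ⊔ W).mkQ (IsNoetherian.noetherian _) ?_
    rwa [Submodule.ker_mkQ, inf_comm, sup_inf_assoc_of_le _ hVL.1, hW.symm.eq_bot, sup_bot_eq]
  have := h _ hess
  exact isNoetherian_of_range_eq_ker _ _ (ker_factor_sup_eq_range (moduleSocle R M) K)

end Socle

/-! ### Separation by maximal submodules and the noetherian property. -/

section RelativeInjectivity

variable {R : Type*} [Ring R] {M : Type v} [AddCommGroup M] [Module R M]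

theorem IsRelativelyInjective.of_linearEquiv {T N : Type*} [AddCommGroup T] [Module R T]
    [AddCommGroup N] [Module R N] (h : IsRelativelyInjective R T N) (e : M ≃ₗ[R] N) :
    IsRelativelyInjective R T M := by
  intro K f
  obtain ⟨g, hg⟩ := h (K.map e.toLinearMap) (f ∘ₗ (e.submoduleMap K).symm.toLinearMap)
  refine ⟨g ∘ₗ e.toLinearMap, fun x => ?_⟩
  have := hg (e.submoduleMap K x)
  simpa using this

/-- If the simple modules are `M`-injective, submodules of `M` are separated by maximal ones. -/
theorem exists_isCoatom_of_lt
    (hinj : ∀ m : Submodule R R, IsCoatom m → IsRelativelyInjective R (R ⧸ m) M)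
    {A B : Submodule R M} (hAB : A < B) : ∃ J, IsCoatom J ∧ A ≤ J ∧ ¬ B ≤ J := by
  obtain ⟨b, hbB, hbA⟩ := SetLike.exists_of_lt hAB
  let ψ : R →ₗ[R] M ⧸ A := LinearMap.toSpanSingleton R (M ⧸ A) (A.mkQ b)
  have hψ1 : ψ 1 = A.mkQ b := one_smul R _
  have hne : LinearMap.ker ψ ≠ ⊤ := fun h => hbA <| by
    have : (1 : R) ∈ LinearMap.ker ψ := h ▸ Submodule.mem_top
    rw [LinearMap.mem_ker, hψ1] at this
    exact (Submodule.Quotient.mk_eq_zero A).1 this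
  obtain ⟨m, hm, hle⟩ := (eq_top_or_exists_le_coatom (LinearMap.ker ψ)).resolve_left hne
  -- A simple quotient of the cyclic module generated by `b` modulo `A`. Pulled back and extended to
  -- `M`, it has the required maximal submodule as kernel.
  let h₀ : LinearMap.range ψ →ₗ[R] R ⧸ m :=
    Submodule.factor hle ∘ₗ ψ.quotKerEquivRange.symm.toLinearMap
  obtain ⟨g, hg⟩ := hinj m hm ((LinearMap.range ψ).comap A.mkQ)
    (h₀ ∘ₗ A.mkQ.submoduleComap (LinearMap.range ψ))
  have hgA : ∀ a ∈ A, g a = 0 := by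
    intro a ha
    have ha0 : A.mkQ a = 0 := (Submodule.Quotient.mk_eq_zero A).2 ha
    have hmem : a ∈ (LinearMap.range ψ).comap A.mkQ := by
      rw [Submodule.mem_comap, ha0]; exact zero_mem _
    rw [hg ⟨a, hmem⟩, LinearMap.comp_apply]
    have : A.mkQ.submoduleComap (LinearMap.range ψ) ⟨a, hmem⟩ = 0 := Subtype.ext ha0
    rw [this, map_zero]
  have hgb : g b ≠ 0 := by
    have hmem : b ∈ (LinearMap.range ψ).comap A.mkQ := ⟨1, hψ1⟩
    have h1 : A.mkQ.submoduleComap (LinearMap.range ψ) ⟨b, hmem⟩ =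
        ⟨ψ 1, LinearMap.mem_range_self ψ 1⟩ := Subtype.ext hψ1.symm
    rw [hg ⟨b, hmem⟩, LinearMap.comp_apply, h1]
    change Submodule.factor hle (ψ.quotKerEquivRange.symm ⟨ψ 1, _⟩) ≠ 0
    rw [LinearMap.quotKerEquivRange_symm_apply_image]
    intro h0
    have h1m : (1 : R) ∈ m := (Submodule.Quotient.mk_eq_zero m).1 h0
    refine hm.1 (eq_top_iff.2 fun r _ => ?_)
    simpa using m.smul_mem r h1m
  have : IsSimpleModule R (R ⧸ m) := isSimpleModule_iff_isCoatom.2 hm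
  refine ⟨LinearMap.ker g, LinearMap.isCoatom_ker_of_surjective
    (LinearMap.surjective_of_ne_zero fun h0 => hgb (by rw [h0]; rfl)), hgA, fun h => hgb (h hbB)⟩

/-- A module is noetherian if its submodules are separated by maximal ones and its quotients have
finite Goldie dimension. -/
theorem isNoetherian_of_finiteGoldie_quotient
    (hsep : ∀ A B : Submodule R M, A < B → ∃ J, IsCoatom J ∧ A ≤ J ∧ ¬ B ≤ J)
    (hfin : ∀ J : Submodule R M, FiniteGoldie R (M ⧸ J)) : IsNoetherian R M := by
  rw [isNoetherian_iff]
  rw [RelEmbedding.wellFounded_iff_isEmpty]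
  refine ⟨fun φ => ?_⟩
  have hlt : ∀ n, φ n < φ (n + 1) := fun n => φ.map_rel_iff.2 (Nat.lt_succ_self n)
  have hmono : Monotone φ := monotone_nat_of_le_succ fun n => (hlt n).le
  choose J hJ hle hnle using fun n => hsep _ _ (hlt n)
  have hcod : ∀ n, (Finset.range n).inf J ⊔ φ n = ⊤ := by
    intro n
    induction n with
    | zero => simp
    | succ n ih =>
      have h1 : J n = φ n ⊔ (Finset.range n).inf J ⊓ J n := by
        rw [← sup_inf_assoc_of_le _ (hle n), sup_comm, ih, top_inf_eq]
      have h2 : J n ⊔ φ (n + 1) = ⊤ := (hJ n).2 _ (left_lt_sup.2 (hnle n))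
      rw [Finset.range_add_one, Finset.inf_insert, eq_top_iff, ← h2]
      refine sup_le (h1.le.trans (sup_le ?_ ?_)) le_sup_right
      · exact (hlt n).le.trans le_sup_right
      · rw [inf_comm]; exact le_sup_left
  -- `U n` lies in `J k` for every `k ≠ n`, but not in `J n` because of `hcod`. So the `U n` are
  -- nonzero and independent modulo `⨅ J`.
  refine not_finiteGoldie_quotient (E := ⨅ n, J n)
    (U := fun n => φ (n + 1) ⊓ (Finset.range n).inf J) (fun n => ?_) (fun n hn => ?_) (hfin _)
  · have h1 : ∀ m k, m ≠ k → φ (m + 1) ⊓ (Finset.range m).inf J ≤ J k := by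
      intro m k hmk
      rcases lt_or_gt_of_ne hmk with hlt' | hlt'
      · exact inf_le_left.trans ((hmono (Nat.succ_le_of_lt hlt')).trans (hle k))
      · exact inf_le_right.trans (Finset.inf_le (Finset.mem_range.2 hlt'))
    refine le_iInf fun k => ?_
    rcases eq_or_ne n k with rfl | hk
    · exact inf_le_right.trans (sup_le (iInf_le J n) (iSup₂_le fun m hm => h1 m n hm))
    · exact inf_le_left.trans (h1 n k hk)
  · refine hnle n ?_
    have h1 : φ (n + 1) = φ n ⊔ (Finset.range n).inf J ⊓ φ (n + 1) := by
      rw [← sup_inf_assoc_of_le _ (hlt n).le, sup_comm, hcod n, top_inf_eq]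
    rw [h1, inf_comm]
    exact sup_le (hle n) (hn.trans (iInf_le J n))

end RelativeInjectivity

/-! ### Simple modules over right `WV`-rings. -/

section WVRing

/-- A singular cyclic module is not isomorphic to `R` unless `R = 0`: the generator `1` has zero
annihilator, and zero is essential only in the zero module. For `R = 0` every `T` vanishes. -/
theorem IsRightWVRing.isRelativelyInjective {R : Type u} [Ring R] (hR : IsRightWVRing R)
    {N : Type v} [AddCommGroup N] [Module Rᵐᵒᵖ N] (hN : IsCyclicModule Rᵐᵒᵖ N)
    (hs : IsSingularModule Rᵐᵒᵖ N) {T : Type u} [AddCommGroup T] [Module Rᵐᵒᵖ T]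
    (hT : IsSimpleModule Rᵐᵒᵖ T) : IsRelativelyInjective Rᵐᵒᵖ T N := by
  obtain ⟨x, hx⟩ := hN
  let f : R →ₗ[Rᵐᵒᵖ] N :=
    { toFun := fun r => MulOpposite.op r • x
      map_add' := fun r s => by rw [MulOpposite.op_add, add_smul]
      map_smul' := fun c r => by
        rw [RingHom.id_apply, smul_smul]
        rfl }
  have hf : Function.Surjective f := by
    intro y
    obtain ⟨c, rfl⟩ := Submodule.mem_span_singleton.1 (hx ▸ Submodule.mem_top : y ∈ _)
    exact ⟨c.unop, rfl⟩
  let e := f.quotKerEquivOfSurjective hf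
  by_cases hiso : Nonempty ((R ⧸ LinearMap.ker f) ≃ₗ[Rᵐᵒᵖ] R)
  · obtain ⟨e'⟩ := hiso
    have hker : LinearMap.ker (LinearMap.toSpanSingleton Rᵐᵒᵖ N (e (e'.symm 1))) = ⊥ := by
      rw [← le_bot_iff]
      intro c hc
      rw [LinearMap.mem_ker, LinearMap.toSpanSingleton_apply, ← map_smul, ← map_smul] at hc
      have h0 : c • (1 : R) = 0 := by simpa using hc
      have h1 : c.unop = 0 := by simpa [MulOpposite.smul_eq_mul_unop] using h0
      exact MulOpposite.unop_injective h1
    have htop := (hker ▸ hs (e (e'.symm 1))).2 ⊤ le_top disjoint_bot_left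
    have : Subsingleton Rᵐᵒᵖ := (Submodule.subsingleton_iff Rᵐᵒᵖ).1
      (subsingleton_of_bot_eq_top htop.symm)
    have := Module.subsingleton Rᵐᵒᵖ T
    exact fun K g => ⟨0, fun y => Subsingleton.elim _ _⟩
  · exact (hR _ hiso T hT).of_linearEquiv e.symm

end WVRing

theorem proposition9 (R : Type u) [Ring R] (C : Type v) [AddCommGroup C] [Module Rᵐᵒᵖ C]
    (hC : IsCyclicModule Rᵐᵒᵖ C)
    (hstar : ∀ (X : Submodule Rᵐᵒᵖ C) (D : Submodule Rᵐᵒᵖ X),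
      IsCyclicModule Rᵐᵒᵖ (X ⧸ D) → SatisfiesStar Rᵐᵒᵖ (X ⧸ D)) :
    HasFiniteUniformDimension Rᵐᵒᵖ (C ⧸ moduleSocle Rᵐᵒᵖ C) ∧
      (IsRightWVRing R → IsNoetherian Rᵐᵒᵖ (C ⧸ moduleSocle Rᵐᵒᵖ C)) := by
  have hcyc : ∀ E : Submodule Rᵐᵒᵖ C, IsCyclicModule Rᵐᵒᵖ (C ⧸ E) := fun E =>
    hC.of_surjective E.mkQ_surjective
  have hsub : ∀ E : Submodule Rᵐᵒᵖ C, EssentialIn E ⊤ →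
      CyclicSubfactorsCSOrNoetherian Rᵐᵒᵖ (C ⧸ E) := fun E hE =>
    cyclicSubfactors_quotient_of_star hE hstar
  refine ⟨(finiteGoldie_quotient_socle fun E hE =>
    (hsub E hE).finiteGoldie (hcyc E)).hasFiniteUniformDimension, fun hR => ?_⟩
  refine isNoetherian_quotient_socle fun E hE => ?_
  refine isNoetherian_of_finiteGoldie_quotient (fun A B hAB => exists_isCoatom_of_lt
    (fun m hm => hR.isRelativelyInjective (hcyc E) (isSingularModule_quotient hE)
      (isSimpleModule_iff_isCoatom.2 hm)) hAB) fun J => ?_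
  exact ((hsub E hE).quotient J).finiteGoldie ((hcyc E).of_surjective J.mkQ_surjective)
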